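/- **Conventions.** A weight function is a continuous, nondecreasing function $\omega:[0,\infty)\to[0,\infty)$ with $\omega(0)=0$ and $\omega(t)\to\infty$ as $t\to\infty$; it is normalized if $\omega=0$ on $[0,1]$. Put $\varphi_\omega(y)=\omega(e^y)$ for $y\in\mathbb R$ and $\varphi^*_\omega(x)=\sup_{y\in\mathbb R}\{xy-\varphi_\omega(y)\}$ for $x\ge 0$. Condition $(\omega_3)$ is $\log t=o(\omega(t))$ as $t\to\infty$; $(\omega_4)$ is convexity of $\varphi_\omega$ on $\mathbb R$. The growth index is $$\gamma(\omega)=\sup\Big\{\gamma>0:\ \exists K>1,\ \limsup_{t\to\infty}\frac{\omega(K^\gamma t)}{\omega(t)}<K\Big\}\in[0,\infty].$$ For a positive sequence $M=(M_p)_{p\in\mathbb N}$ with $M_0=1$, put $\omega_M(t)=\sup_{p}\log(t^p/M_p)$ for $t>0$ and $\omega_M(0)=0$. $M$ is log-convex if $M_j^2\le M_{j-1}M_{j+1}$ for all $j\ge1$, and strongly log-convex if $(M_p/p!)_p$ is log-convex. A family $(M^x)_{x>0}$ of positive sequences is a standard log-convex weight matrix if each $M^x$ is nondecreasing, log-convex,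 satisfies $1=M^x_0\le M^x_1$ and $(M^x_p)^{1/p}\to\infty$, and $M^x_p\le M^y_p$ for all $p$ whenever $x\le y$. Two families are $\{\approx\}$-equivalent, $\mathcal M\{\approx\}\mathcal N$, if for every $x>0$ there are $y>0$ and $C\ge1$ with $M^x_p\le C^pN^y_p$ for all $p$, and conversely with $\mathcal M$ and $\mathcal N$ interchanged. Let $S$ be an unbounded sector $\{z:|\arg z-d|<\gamma\pi/2\}$ ($d\in\mathbb R$, $\gamma>0$) of the Riemann surface of the logarithm, with holomorphic functions $\mathcal H(S)$. For a family $\mathcal M=(M^x)_{x>0}$ of positive sequences, resp. for a function $\omega$, put $$\mathcal A_{\{\mathcal M\}}(S)=\bigcup_{x,h>0}\Big\{f\in\mathcal H(S):\sup_{z\in S,\,p\in\mathbb N}\frac{|f^{(p)}(z)|}{h^pM^x_p}<\infty\Big\},\qquad \mathcal A_{\{\omega\}}(S)=\bigcup_{l>0}\Big\{f\in\mathcal H(S):\sup_{z\in S,\,p\in\mathbb N}\frac{|f^{(p)}(z)|}{\exp(\frac1l\varphi^*_\omega(lp))}<\infty\Big\},$$ each with the locally convex inductive limit topology of the normed spaces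 in the union (the norm is the displayed supremum). The spaces $\Lambda_{\{\mathcal M\}}$, $\Lambda_{\{\omega\}}$ of complex sequences $a=(a_p)_p$ are defined in the same way, with $\sup_p|a_p|/(h^pM^x_p)$ and $\sup_p|a_p|/\exp(\frac1l\varphi^*_\omega(lp))$, respectively. **Statement.** Let $\omega$ be a normalized weight function satisfying $(\omega_3)$, $(\omega_4)$ and $\gamma(\omega)>1$. Let $\Omega=\{W^x:x>0\}$ with $W^x_p=\exp(\frac1x\varphi^*_\omega(xp))$, let $w^1=(W^1_p/p!)_p$ and $\tau=\omega_{w^1}$, and let $\widehat{\mathcal T}=\{\widehat T^x:x>0\}$ with $\widehat T^x_p=p!\,T^x_p$ and $T^x_p=\exp(\frac1x\varphi^*_\tau(xp))$. Then: 1. For every such sector $S$, as locally convex vector spaces, $$\mathcal A_{\{\Omega\}}(S)=\mathcal A_{\{\omega\}}(S)=\mathcal A_{\{\omega_{\widehat T^1}\}}(S)=\mathcal A_{\{\widehat{\mathcal T}\}}(S).$$ 2. Likewise, as locally convex vector spaces, $\Lambda_{\{\Omega\}}=\Lambda_{\{\omega\}}=\Lambda_{\{\omega_{\widehat T^1}\}}=\Lambda_{\{\widehat{\mathcal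 T}\}}$. 3. $\Omega\,\{\approx\}\,\widehat{\mathcal T}$, and every $\widehat T^x$ is strongly log-convex. 4. There is a constant $c\ge1$ such that $\{(c^p\,\widehat T^x_p)_p:x>0\}$ is a standard log-convex weight matrix; if $\tau$ is a normalized weight function, then $\widehat{\mathcal T}$ itself is one. -/

import Mathlib

open Filter Topology Asymptotics
open scoped ENNReal Nat

noncomputable section

namespace Ultraholo

/-! ### Weight functions -/

/-- Weight functions on `[0,∞)`, represented by functions on `ℝ` of which only the values on
`[0,∞)` matter: continuous, nondecreasing, `ω 0 = 0`, `ω → ∞`. -/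
structure IsWeight (ω : ℝ → ℝ) : Prop where
  continuousOn : ContinuousOn ω (Set.Ici 0)
  monotoneOn : MonotoneOn ω (Set.Ici 0)
  map_zero : ω 0 = 0
  tendsto_atTop : Tendsto ω atTop atTop

/-- A normalized weight vanishes on `[0,1]`. -/
structure IsNormalizedWeight (ω : ℝ → ℝ) : Prop extends IsWeight ω where
  eq_zero : ∀ t ∈ Set.Icc (0 : ℝ) 1, ω t = 0

/-- `log t = o(ω t)` as `t → ∞`. -/
def Omega3 (ω : ℝ → ℝ) : Prop := Real.log =o[atTop] ω

/-- The function `φ_ω(t) = ω(e^t)`. -/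
def phi (ω : ℝ → ℝ) (t : ℝ) : ℝ := ω (Real.exp t)

/-- `φ_ω` is convex on `ℝ`. -/
def Omega4 (ω : ℝ → ℝ) : Prop := ConvexOn ℝ Set.univ (phi ω)

/-- Condition `(P_{ω,γ})`: for some `K > 1`, `limsup_{t → ∞} ω(K^γ t)/ω(t) < K`.
The upper limit is taken in the extended reals. -/
def GrowthProp (ω : ℝ → ℝ) (γ : ℝ) : Prop :=
  ∃ K : ℝ, 1 < K ∧ limsup (fun t : ℝ => ((ω (K ^ γ * t) / ω t : ℝ) : EReal)) atTop < (K : EReal)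

/-- The growth index `γ(ω) = sup {γ > 0 : (P_{ω,γ})}`, with values in `[0,∞]`. -/
def growthIndex (ω : ℝ → ℝ) : ℝ≥0∞ :=
  ⨆ γ ∈ {γ : ℝ | 0 < γ ∧ GrowthProp ω γ}, ENNReal.ofReal γ

/-- The conjugate `φ*_ω(x) = sup {x y - φ_ω(y) : y ∈ ℝ}` (used for `x ≥ 0`). -/
def phiStar (ω : ℝ → ℝ) (x : ℝ) : ℝ := ⨆ y : ℝ, (x * y - phi ω y)

/-! ### Weight sequences and weight matrices

A matrix is a family `x ↦ M x` of sequences; only the indices `x > 0` matter. -/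

/-- The matrix associated with a weight function: `W^x_p = exp ((1/x) φ*_ω(x p))`. -/
def assocMatrix (ω : ℝ → ℝ) (x : ℝ) (p : ℕ) : ℝ :=
  Real.exp (1 / x * phiStar ω (x * p))

/-- `m_p = M_p / p!`. -/
def divFactorial (M : ℕ → ℝ) (p : ℕ) : ℝ := M p / (p ! : ℝ)

/-- `p! M_p`. -/
def mulFactorial (M : ℕ → ℝ) (p : ℕ) : ℝ := (p ! : ℝ) * M p

/-- The function associated with a sequence: `ω_M(t) = sup_p log (t^p / M_p)` for `t > 0`
and `ω_M(0) = 0`. -/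
def assocFun (M : ℕ → ℝ) (t : ℝ) : ℝ :=
  if t = 0 then 0 else ⨆ p : ℕ, Real.log (t ^ p / M p)

/-- Log-convexity: `M_j ^ 2 ≤ M_{j-1} M_{j+1}` for `j ≥ 1`. -/
def LogConvex (M : ℕ → ℝ) : Prop := ∀ j : ℕ, M (j + 1) ^ 2 ≤ M j * M (j + 2)

/-- Strong log-convexity: `(M_p / p!)_p` is log-convex. -/
def StronglyLogConvex (M : ℕ → ℝ) : Prop := LogConvex (divFactorial M)

/-- The class `LC`: positive, normalized (`1 = M_0 ≤ M_1`), log-convex sequences with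
`(M_p)^{1/p} → ∞`. -/
structure IsLC (M : ℕ → ℝ) : Prop where
  pos : ∀ p, 0 < M p
  map_zero : M 0 = 1
  one_le : 1 ≤ M 1
  logConvex : LogConvex M
  tendsto_root : Tendsto (fun p : ℕ => M p ^ (1 / (p : ℝ))) atTop atTop

/-- Standard log-convex weight matrices: every member is nondecreasing and of class `LC`, and the
members increase pointwise with the index. -/
structure IsStandardLogConvex (M : ℝ → ℕ → ℝ) : Prop where
  isLC : ∀ x, 0 < x → IsLC (M x)
  monotone : ∀ x, 0 < x → Monotone (M x)
  le_of_le : ∀ x y, 0 < x → x ≤ y → ∀ p, M x p ≤ M y p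

/-- `M ≾ N`: `M_p ≤ C^p N_p` for some `C ≥ 1` and all `p`. -/
def SeqLE (M N : ℕ → ℝ) : Prop := ∃ C : ℝ, 1 ≤ C ∧ ∀ p, M p ≤ C ^ p * N p

/-- `M {≾} N` for matrices. -/
def MatrixLE (M N : ℝ → ℕ → ℝ) : Prop := ∀ x, 0 < x → ∃ y, 0 < y ∧ SeqLE (M x) (N y)

/-- `M {≈} N` for matrices. -/
def MatrixEquiv (M N : ℝ → ℕ → ℝ) : Prop := MatrixLE M N ∧ MatrixLE N M

/-! ### Weighted spaces and their inductive limits -/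

section InductiveLimit

variable {E : Type*} [AddCommGroup E] [Module ℂ E] {J : Type*} {ι : Type*}

/-- A linear subspace of `E` together with a topology on it. An equality between two such objects
says that the subspaces are the same and that their topologies are the same. -/
structure TopSubspace (E : Type*) [AddCommGroup E] [Module ℂ E] where
  carrier : Submodule ℂ E
  topology : TopologicalSpace carrier

/-- The space of all `f` with `sup_j |L_j f| / w_j < ∞`, for linear forms `L_j` and positive
weights `w_j`. -/
def weightedSpace (L : J → E →ₗ[ℂ] ℂ) (w : J → ℝ) : Submodule ℂ E where
  carrier := {f | ∃ C : ℝ, ∀ j, ‖L j f‖ ≤ C * w j}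
  zero_mem' := ⟨0, fun j => by simp⟩
  add_mem' := by
    rintro f g ⟨C, hC⟩ ⟨D, hD⟩
    refine ⟨C + D, fun j => ?_⟩
    rw [map_add, add_mul]
    exact (norm_add_le _ _).trans (add_le_add (hC j) (hD j))
  smul_mem' := by
    rintro c f ⟨C, hC⟩
    refine ⟨‖c‖ * C, fun j => ?_⟩
    rw [map_smul, norm_smul, mul_assoc]
    exact mul_le_mul_of_nonneg_left (hC j) (norm_nonneg c)

/-- The norm `sup_j |L_j f| / w_j` of `weightedSpace L w`. -/
def weightedNorm (L : J → E →ₗ[ℂ] ℂ) (w : J → ℝ) (f : E) : ℝ := ⨆ j, ‖L j f‖ / w j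

/-- The topologies on `⨆ i, A i` that turn it into a locally convex topological vector space and
for which every inclusion of a normed space `(A i, q i)` is continuous (by linearity: continuous
at `0`). -/
def lcTopologies (A : ι → Submodule ℂ E) (q : ι → E → ℝ) :
    Set (TopologicalSpace (⨆ i, A i : Submodule ℂ E)) :=
  {t | @IsTopologicalAddGroup _ t _ ∧ @ContinuousSMul ℂ _ _ _ t ∧
    @LocallyConvexSpace ℝ _ _ _ _ _ t ∧
    ∀ i, ∀ V ∈ @nhds _ t 0, ∃ ε : ℝ, 0 < ε ∧
      ∀ f (hf : f ∈ A i), q i f < ε → (⟨f, Submodule.mem_iSup_of_mem i hf⟩ : ↥(⨆ i, A i)) ∈ V}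

/-- The locally convex inductive limit of a directed family of normed spaces `(A i, q i)`: their
union (for a directed family this is the supremum of the subspaces, see
`coe_inductiveLimit_of_directed`) with the finest locally convex topology for which all inclusions
are continuous. In the order of Mathlib finer topologies are smaller. -/
def inductiveLimit (A : ι → Submodule ℂ E) (q : ι → E → ℝ) : TopSubspace E where
  carrier := ⨆ i, A i
  topology := sInf (lcTopologies A q)

theorem coe_inductiveLimit_of_directed [Nonempty ι] (A : ι → Submodule ℂ E) (q : ι → E → ℝ)
    (h : Directed (· ≤ ·) A) : ((inductiveLimit A q).carrier : Set E) = ⋃ i, (A i : Set E) :=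
  Submodule.coe_iSup_of_directed A h

/-- The infimum defining the topology of `inductiveLimit` is attained. -/
theorem sInf_lcTopologies_mem (A : ι → Submodule ℂ E) (q : ι → E → ℝ) :
    sInf (lcTopologies A q) ∈ lcTopologies A q := by
  refine ⟨topologicalAddGroup_sInf fun t ht => ht.1, continuousSMul_sInf fun t ht => ht.2.1,
    LocallyConvexSpace.sInf fun t ht => ht.2.2.1, ?_⟩
  intro i V hV
  have key : ∀ V : Set ↥(⨆ i, A i), V ∈ (⨅ t ∈ lcTopologies A q, @nhds _ t 0) →
      ∃ ε : ℝ, 0 < ε ∧ ∀ f (hf : f ∈ A i), q i f < ε →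
        (⟨f, Submodule.mem_iSup_of_mem i hf⟩ : ↥(⨆ i, A i)) ∈ V := by
    let F : Filter ↥(⨆ i, A i) :=
      { sets := {V | ∃ ε : ℝ, 0 < ε ∧ ∀ f (hf : f ∈ A i), q i f < ε →
          (⟨f, Submodule.mem_iSup_of_mem i hf⟩ : ↥(⨆ i, A i)) ∈ V}
        univ_sets := ⟨1, one_pos, fun _ _ _ => trivial⟩
        sets_of_superset := fun ⟨ε, h0, h⟩ hs => ⟨ε, h0, fun f hf hq => hs (h f hf hq)⟩
        inter_sets := fun ⟨ε, h0, h⟩ ⟨δ, k0, k⟩ => ⟨min ε δ, lt_min h0 k0, fun f hf hq =>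
          ⟨h f hf (hq.trans_le (min_le_left _ _)), k f hf (hq.trans_le (min_le_right _ _))⟩⟩ }
    intro V hV
    have : F ≤ ⨅ t ∈ lcTopologies A q, @nhds _ t 0 :=
      le_iInf₂ fun t ht V hV => ht.2.2.2 i V hV
    exact this hV
  apply key
  have h2 : @nhds _ (sInf (lcTopologies A q)) 0 = ⨅ t ∈ lcTopologies A q, @nhds _ t 0 :=
    nhds_sInf
  exact h2 ▸ hV

end InductiveLimit

/-! ### Holomorphic functions on sectors of the Riemann surface of the logarithm

The Riemann surface of the logarithm is the universal covering `exp : ℂ → ℂ \ {0}`. A point `z` of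
it is recorded by its logarithm `ζ = log |z| + i arg z`, which is a global coordinate. -/

/-- The unbounded sector `{z : |arg z - d| < γ π / 2}`, in the coordinate `ζ = log z`. -/
def sector (d γ : ℝ) : Set ℂ := {ζ | |ζ.im - d| < γ * Real.pi / 2}

theorem isOpen_sector (d γ : ℝ) : IsOpen (sector d γ) :=
  isOpen_lt (by fun_prop) continuous_const

/-- Extension by zero of a function on a sector; derivatives at points of the (open) sector do not
depend on it. -/
def ext0 {S : Set ℂ} (f : S → ℂ) : ℂ → ℂ := Function.extend Subtype.val f 0

theorem ext0_apply {S : Set ℂ} (f : S → ℂ) (z : S) : ext0 f z = f z :=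
  Subtype.val_injective.extend_apply f 0 z

theorem ext0_add {S : Set ℂ} (f g : S → ℂ) : ext0 (f + g) = ext0 f + ext0 g := by
  have h := Function.extend_add (Subtype.val : S → ℂ) f g 0 0
  rwa [add_zero] at h

theorem ext0_smul {S : Set ℂ} (c : ℂ) (f : S → ℂ) : ext0 (c • f) = c • ext0 f := by
  have h := Function.extend_smul c (Subtype.val : S → ℂ) f 0
  rwa [smul_zero] at h

theorem ext0_zero {S : Set ℂ} : ext0 (0 : S → ℂ) = 0 := by
  have h := ext0_smul (S := S) 0 0
  rwa [zero_smul, zero_smul] at h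

/-- The space `H(S)` of holomorphic functions on a sector. -/
def Hol (d γ : ℝ) : Submodule ℂ (sector d γ → ℂ) where
  carrier := {f | DifferentiableOn ℂ (ext0 f) (sector d γ)}
  zero_mem' := by
    rw [Set.mem_ofPred_eq, ext0_zero]
    exact differentiableOn_const 0
  add_mem' := by
    intro f g hf hg
    rw [Set.mem_ofPred_eq, ext0_add]
    exact DifferentiableOn.add hf hg
  smul_mem' := by
    intro c f hf
    rw [Set.mem_ofPred_eq, ext0_smul]
    exact DifferentiableOn.const_smul hf c

/-- The complex derivative `f ↦ df/dz` on `H(S)`. In the coordinate `ζ = log z` it is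
`e^{-ζ} df/dζ`. -/
def derivZ (d γ : ℝ) : Hol d γ →ₗ[ℂ] Hol d γ where
  toFun f := ⟨fun ζ => Complex.exp (-ζ) * deriv (ext0 f.1) ζ, by
    have h : DifferentiableOn ℂ (fun ζ => Complex.exp (-ζ) * deriv (ext0 f.1) ζ) (sector d γ) :=
      DifferentiableOn.mul (by fun_prop) (DifferentiableOn.deriv f.2 (isOpen_sector d γ))
    exact h.congr fun ζ hζ => ext0_apply _ ⟨ζ, hζ⟩⟩
  map_add' f g := by
    ext ζ
    have hf := f.2.differentiableAt ((isOpen_sector d γ).mem_nhds ζ.2)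
    have hg := g.2.differentiableAt ((isOpen_sector d γ).mem_nhds ζ.2)
    simp [ext0_add, deriv_add hf hg, mul_add]
  map_smul' c f := by
    ext ζ
    have hf := f.2.differentiableAt ((isOpen_sector d γ).mem_nhds ζ.2)
    simp only [Submodule.coe_smul, ext0_smul, deriv_const_smul c hf, Pi.smul_apply, smul_eq_mul,
      RingHom.id_apply]
    ring

/-- The linear form `f ↦ f^{(p)}(z)` on `H(S)`. -/
def derivAt (d γ : ℝ) (zp : sector d γ × ℕ) : Hol d γ →ₗ[ℂ] ℂ :=
  (LinearMap.proj zp.1).comp ((Hol d γ).subtype.comp (derivZ d γ ^ zp.2))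

/-! ### The classes of Roumieu type -/

/-- Index sets `(0,∞)`. -/
abbrev PosReal : Type := Set.Ioi (0 : ℝ)

/-- `A_{ {M} }(S)` for a matrix `M`: the inductive limit over `x > 0`, `h > 0` of the spaces of
all `f ∈ H(S)` with `sup_{z,p} |f^{(p)}(z)| / (h^p M^x_p) < ∞`. -/
def classA_matrix (M : ℝ → ℕ → ℝ) (d γ : ℝ) : TopSubspace (Hol d γ) :=
  inductiveLimit (ι := PosReal × PosReal)
    (fun i => weightedSpace (derivAt d γ) fun zp => (i.2 : ℝ) ^ zp.2 * M i.1 zp.2)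
    (fun i => weightedNorm (derivAt d γ) fun zp => (i.2 : ℝ) ^ zp.2 * M i.1 zp.2)

/-- `A_{ {ω} }(S)` for a weight function `ω`: the inductive limit over `l > 0` of the spaces of
all `f ∈ H(S)` with `sup_{z,p} |f^{(p)}(z)| / exp ((1/l) φ*_ω(l p)) < ∞`. -/
def classA_weight (ω : ℝ → ℝ) (d γ : ℝ) : TopSubspace (Hol d γ) :=
  inductiveLimit (ι := PosReal)
    (fun l => weightedSpace (derivAt d γ) fun zp => Real.exp (1 / l * phiStar ω (l * zp.2)))
    (fun l => weightedNorm (derivAt d γ) fun zp => Real.exp (1 / l * phiStar ω (l * zp.2)))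

/-- The linear form `a ↦ a_p` on complex sequences. -/
def coord (p : ℕ) : (ℕ → ℂ) →ₗ[ℂ] ℂ := LinearMap.proj p

/-- The sequence class `Λ_{ {M} }` of a matrix. -/
def classLambda_matrix (M : ℝ → ℕ → ℝ) : TopSubspace (ℕ → ℂ) :=
  inductiveLimit (ι := PosReal × PosReal)
    (fun i => weightedSpace coord fun p => (i.2 : ℝ) ^ p * M i.1 p)
    (fun i => weightedNorm coord fun p => (i.2 : ℝ) ^ p * M i.1 p)

/-- The sequence class `Λ_{ {ω} }` of a weight function. -/
def classLambda_weight (ω : ℝ → ℝ) : TopSubspace (ℕ → ℂ) :=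
  inductiveLimit (ι := PosReal)
    (fun l => weightedSpace coord fun p => Real.exp (1 / l * phiStar ω (l * p)))
    (fun l => weightedNorm coord fun p => Real.exp (1 / l * phiStar ω (l * p)))

end Ultraholo

end

open Ultraholo

/-! All spaces in the statement are inductive limits of weighted spaces over the same linear forms,
so carriers and topologies agree as soon as the families of weights dominate one another up to
constants (`inductiveLimit_weighted_congr`). What remains are estimates for log W^x_p = sup_t (p log
t - ω(t)/x), written `logMatrix`.

The hypothesis γ(ω) > 1 enters through `exists_growth_bound`, ω(ru) ≤ (εr + D) ω(u). Fixed dilations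
thus cost only a change of index, which absorbs geometric factors (`exists_absorb`). Moreover ω(s) =
o(s), which makes τ finite, and τ(u/ω(u)) ≤ D ω(u) for large u (`exists_tau_div_le`).

The equivalence of W and p! T has two halves. For W ≾ p! T, insert t = u/ω(u) into the supremum
defining T; the resulting p log ω(u) costs p log p, that is log p! up to a geometric factor, plus a
multiple of ω(u) paid for by a larger index (`exists_logMatrix_le_tau`). For p! T ≾ W, use T^n_p ≤
(W^1_{np}/(np)!)^{1/n}, where (W^1_{np})^{1/n} = W^n_p and (np)!^{1/n} ≥ e^{-p} p!
(`logMatrix_tau_le`). Applied to the row p! T^1, the same two comparisons give the weight function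
class in the middle.

Log-convexity of T holds because a supremum of functions affine in p is convex. As τ vanishes at
some t₀ > 0, T^x_p ≥ t₀^p, and a factor c^p with c t₀ ≥ 1 yields the normalization in the last
assertion. -/

namespace Ultraholo

/-! ### Comparison of inductive limits -/

section Comparison

variable {E : Type*} [AddCommGroup E] [Module ℂ E] {J ι κ : Type*}

/-- `lcTopologies` with the ambient union replaced by any subspace containing all steps. -/
def lcTopologiesOn (S : Submodule ℂ E) (A : ι → Submodule ℂ E) (q : ι → E → ℝ)
    (h : ∀ i, A i ≤ S) : Set (TopologicalSpace S) :=
  {t | @IsTopologicalAddGroup _ t _ ∧ @ContinuousSMul ℂ _ _ _ t ∧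
    @LocallyConvexSpace ℝ _ _ _ _ _ t ∧
    ∀ i, ∀ V ∈ @nhds _ t 0, ∃ ε : ℝ, 0 < ε ∧
      ∀ f (hf : f ∈ A i), q i f < ε → (⟨f, h i hf⟩ : S) ∈ V}

/-- The carrier is a free variable so that two limits can be put on one common carrier; then only
their topologies have to be compared, without transport along an equality of types. -/
theorem inductiveLimit_eq_on (S : Submodule ℂ E) (A : ι → Submodule ℂ E) (q : ι → E → ℝ)
    (h : ∀ i, A i ≤ S) (hS : S = ⨆ i, A i) :
    inductiveLimit A q = ⟨S, sInf (lcTopologiesOn S A q h)⟩ := by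
  subst hS
  rfl

/-- Each inclusion of an A-step factors continuously through a B-step, so a topology making the
B-inclusions continuous does the same for the A-inclusions. -/
theorem lcTopologiesOn_subset (S : Submodule ℂ E) {A : ι → Submodule ℂ E} {q : ι → E → ℝ}
    {B : κ → Submodule ℂ E} {r : κ → E → ℝ} (hA : ∀ i, A i ≤ S) (hB : ∀ j, B j ≤ S)
    (h : ∀ i, ∃ j, A i ≤ B j ∧ ∃ C : ℝ, 0 < C ∧ ∀ f ∈ A i, r j f ≤ C * q i f) :
    lcTopologiesOn S B r hB ⊆ lcTopologiesOn S A q hA := by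
  rintro t ⟨h1, h2, h3, h4⟩
  refine ⟨h1, h2, h3, fun i V hV => ?_⟩
  obtain ⟨j, hj, C, hC, hq⟩ := h i
  obtain ⟨ε, hε, H⟩ := h4 j V hV
  refine ⟨ε / C, div_pos hε hC, fun f hf hlt => H f (hj hf) ((hq f hf).trans_lt ?_)⟩
  rw [lt_div_iff₀ hC] at hlt
  linarith

theorem inductiveLimit_congr {A : ι → Submodule ℂ E} {q : ι → E → ℝ}
    {B : κ → Submodule ℂ E} {r : κ → E → ℝ}
    (h : ∀ i, ∃ j, A i ≤ B j ∧ ∃ C : ℝ, 0 < C ∧ ∀ f ∈ A i, r j f ≤ C * q i f)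
    (h' : ∀ j, ∃ i, B j ≤ A i ∧ ∃ C : ℝ, 0 < C ∧ ∀ f ∈ B j, q i f ≤ C * r j f) :
    inductiveLimit A q = inductiveLimit B r := by
  have hAB : (⨆ i, A i) = ⨆ j, B j := by
    apply le_antisymm
    · exact iSup_le fun i => (h i).elim fun j hj => hj.1.trans (le_iSup B j)
    · exact iSup_le fun j => (h' j).elim fun i hi => hi.1.trans (le_iSup A i)
  rw [inductiveLimit_eq_on (⨆ i, A i) A q (le_iSup A) rfl,
    inductiveLimit_eq_on (⨆ i, A i) B r (fun j => hAB ▸ le_iSup B j) hAB]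
  congr 2
  exact (lcTopologiesOn_subset _ _ _ h').antisymm (lcTopologiesOn_subset _ _ _ h)

theorem weightedSpace_mono (L : J → E →ₗ[ℂ] ℂ) {v w : J → ℝ} {C : ℝ} (hC : 0 < C)
    (hv : ∀ j, 0 < v j) (hw : ∀ j, 0 < w j) (h : ∀ j, v j ≤ C * w j) :
    weightedSpace L v ≤ weightedSpace L w ∧
      ∃ C : ℝ, 0 < C ∧ ∀ f ∈ weightedSpace L v, weightedNorm L w f ≤ C * weightedNorm L v f := by
  constructor
  · rintro f ⟨D, hD⟩
    refine ⟨|D| * C, fun j => (hD j).trans ?_⟩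
    calc D * v j ≤ |D| * v j := mul_le_mul_of_nonneg_right (le_abs_self D) (hv j).le
      _ ≤ |D| * (C * w j) := mul_le_mul_of_nonneg_left (h j) (abs_nonneg D)
      _ = |D| * C * w j := by ring
  · refine ⟨C, hC, ?_⟩
    rintro f ⟨D, hD⟩
    -- Membership supplies boundedness; an unbounded real supremum would default to 0 and bound
    -- nothing.
    have hb : BddAbove (Set.range fun j => ‖L j f‖ / v j) :=
      ⟨D, by rintro _ ⟨j, rfl⟩; exact (div_le_iff₀ (hv j)).2 (hD j)⟩
    refine Real.iSup_le (fun j => ?_) (mul_nonneg hC.le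
      (Real.iSup_nonneg fun j => div_nonneg (norm_nonneg _) (hv j).le))
    have h1 : ‖L j f‖ ≤ weightedNorm L v f * v j :=
      (div_le_iff₀ (hv j)).1 (le_ciSup hb j)
    have h0 : 0 ≤ weightedNorm L v f :=
      Real.iSup_nonneg fun j => div_nonneg (norm_nonneg _) (hv j).le
    rw [div_le_iff₀ (hw j)]
    calc ‖L j f‖ ≤ weightedNorm L v f * v j := h1
      _ ≤ weightedNorm L v f * (C * w j) := mul_le_mul_of_nonneg_left (h j) h0
      _ = C * weightedNorm L v f * w j := by ring

/-- Families of weights on `ℕ` dominating each other give the same inductive limit. -/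
theorem inductiveLimit_weighted_congr (L : J → E →ₗ[ℂ] ℂ) (π : J → ℕ) {v : ι → ℕ → ℝ}
    {w : κ → ℕ → ℝ} (hv : ∀ i p, 0 < v i p) (hw : ∀ i p, 0 < w i p)
    (h : ∀ i, ∃ j, ∃ C : ℝ, 0 < C ∧ ∀ p, v i p ≤ C * w j p)
    (h' : ∀ j, ∃ i, ∃ C : ℝ, 0 < C ∧ ∀ p, w j p ≤ C * v i p) :
    inductiveLimit (fun i => weightedSpace L fun j => v i (π j))
        (fun i => weightedNorm L fun j => v i (π j)) =
      inductiveLimit (fun i => weightedSpace L fun j => w i (π j))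
        (fun i => weightedNorm L fun j => w i (π j)) := by
  apply inductiveLimit_congr
  · intro i
    obtain ⟨j, C, hC, H⟩ := h i
    exact ⟨j, weightedSpace_mono L hC (fun _ => hv _ _) (fun _ => hw _ _) fun _ => H _⟩
  · intro j
    obtain ⟨i, C, hC, H⟩ := h' j
    exact ⟨i, weightedSpace_mono L hC (fun _ => hw _ _) (fun _ => hv _ _) fun _ => H _⟩

end Comparison

/-! ### The associated matrix -/

/-- `φ_ω` grows faster than every linear function, so that `φ*_ω` is finite on `[0,∞)`. -/
def FiniteConjugate (ω : ℝ → ℝ) : Prop :=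
  ∀ x : ℝ, 0 ≤ x → BddAbove (Set.range fun y : ℝ => x * y - phi ω y)

/-- The logarithm `(1/x) φ*_ω(x p)` of the associated matrix. -/
noncomputable def logMatrix (ω : ℝ → ℝ) (x : ℝ) (p : ℕ) : ℝ := 1 / x * phiStar ω (x * p)

theorem assocMatrix_eq (ω : ℝ → ℝ) (x : ℝ) (p : ℕ) :
    assocMatrix ω x p = Real.exp (logMatrix ω x p) := rfl

/-- Together with `le_logMatrix` this replaces the conjugate by sup_{t>0} (p log t - ω(t)/x), via y
= log t; later estimates choose a suitable t. -/
theorem logMatrix_le {ω : ℝ → ℝ} {x B : ℝ} {p : ℕ} (hx : 0 < x)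
    (h : ∀ t, 0 < t → p * Real.log t - ω t / x ≤ B) : logMatrix ω x p ≤ B := by
  have : phiStar ω (x * p) ≤ x * B := ciSup_le fun y => by
    have h1 := mul_le_mul_of_nonneg_left (h (Real.exp y) (Real.exp_pos y)) hx.le
    rw [Real.log_exp, mul_sub, mul_div_cancel₀ _ hx.ne'] at h1
    unfold phi
    linarith
  unfold logMatrix
  rw [one_div, inv_mul_le_iff₀ hx]
  exact this

theorem le_logMatrix {ω : ℝ → ℝ} (hω : FiniteConjugate ω) {x t : ℝ} (hx : 0 < x) (ht : 0 < t)
    (p : ℕ) : p * Real.log t - ω t / x ≤ logMatrix ω x p := by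
  have h := le_ciSup (hω (x * p) (by positivity)) (Real.log t)
  simp only [phi, Real.exp_log ht] at h
  unfold logMatrix
  rw [one_div, le_inv_mul_iff₀ hx, mul_sub, mul_div_cancel₀ _ hx.ne', ← mul_assoc]
  exact h

theorem logMatrix_mono {ω : ℝ → ℝ} (hω : FiniteConjugate ω) (h0 : ∀ t, 0 < t → 0 ≤ ω t)
    {x y : ℝ} (hx : 0 < x) (hxy : x ≤ y) (p : ℕ) : logMatrix ω x p ≤ logMatrix ω y p := by
  refine logMatrix_le hx fun t ht => le_trans ?_ (le_logMatrix hω (hx.trans_le hxy) ht p)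
  exact sub_le_sub_left (div_le_div_of_nonneg_left (h0 t ht) hx hxy) _

/-- For each fixed t the term p log t - ω(t)/x is affine in p, so the supremum over t is convex in
p. -/
theorem logConvex_assocMatrix {ω : ℝ → ℝ} (hω : FiniteConjugate ω) {x : ℝ} (hx : 0 < x) :
    LogConvex (assocMatrix ω x) := by
  intro j
  have h : logMatrix ω x (j + 1) ≤ (logMatrix ω x j + logMatrix ω x (j + 2)) / 2 := by
    refine logMatrix_le hx fun t ht => ?_
    have h1 := le_logMatrix hω hx ht j
    have h2 := le_logMatrix hω hx ht (j + 2)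
    push_cast at h2 ⊢
    linarith
  simp only [assocMatrix_eq]
  rw [← Real.exp_add, ← Real.exp_nat_mul]
  apply Real.exp_le_exp.2
  push_cast
  linarith

theorem logMatrix_zero_le {ω : ℝ → ℝ} (h0 : ∀ t, 0 < t → 0 ≤ ω t) {x : ℝ} (hx : 0 < x) :
    logMatrix ω x 0 ≤ 0 :=
  logMatrix_le hx fun t ht => by
    have := div_nonneg (h0 t ht) hx.le
    simpa using this

theorem mul_log_le_logMatrix {ω : ℝ → ℝ} (hω : FiniteConjugate ω) {x t : ℝ} (hx : 0 < x)
    (ht : 0 < t) (hωt : ω t ≤ 0) (p : ℕ) : p * Real.log t ≤ logMatrix ω x p := by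
  have h1 := le_logMatrix hω hx ht p
  have h2 := div_nonpos_of_nonpos_of_nonneg hωt hx.le
  linarith

/-! ### The function associated with a sequence -/

theorem log_pow_div {M : ℕ → ℝ} (hM : ∀ p, 0 < M p) {t : ℝ} (ht : 0 < t) (p : ℕ) :
    Real.log (t ^ p / M p) = p * Real.log t - Real.log (M p) := by
  rw [Real.log_div (pow_pos ht p).ne' (hM p).ne', Real.log_pow]

theorem assocFun_le {M : ℕ → ℝ} (hM : ∀ p, 0 < M p) {t B : ℝ} (ht : 0 < t)
    (h : ∀ p : ℕ, p * Real.log t - Real.log (M p) ≤ B) : assocFun M t ≤ B := by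
  rw [assocFun, if_neg ht.ne']
  exact ciSup_le fun p => (log_pow_div hM ht p).trans_le (h p)

/-- `ω_M` is finite on `(0,∞)`. -/
def FiniteAssocFun (M : ℕ → ℝ) : Prop :=
  ∀ t, 0 < t → ∃ B : ℝ, ∀ p : ℕ, p * Real.log t - Real.log (M p) ≤ B

theorem le_assocFun {M : ℕ → ℝ} (hM : ∀ p, 0 < M p) (hfin : FiniteAssocFun M) {t : ℝ}
    (ht : 0 < t) (p : ℕ) : p * Real.log t - Real.log (M p) ≤ assocFun M t := by
  obtain ⟨B, hB⟩ := hfin t ht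
  rw [assocFun, if_neg ht.ne', ← log_pow_div hM ht]
  refine le_ciSup (f := fun p : ℕ => Real.log (t ^ p / M p)) ⟨B, ?_⟩ p
  rintro _ ⟨q, rfl⟩
  exact (log_pow_div hM ht q).trans_le (hB q)

theorem assocFun_nonneg {M : ℕ → ℝ} (hM : ∀ p, 0 < M p) (hM0 : M 0 = 1)
    (hfin : FiniteAssocFun M) {t : ℝ} (ht : 0 < t) : 0 ≤ assocFun M t := by
  simpa [hM0] using le_assocFun hM hfin ht 0

theorem finiteConjugate_assocFun {M : ℕ → ℝ} (hM : ∀ p, 0 < M p) (hM0 : M 0 = 1)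
    (hfin : FiniteAssocFun M) : FiniteConjugate (assocFun M) := by
  intro x hx
  -- For y ≤ 0 the value is at most 0; for y ≥ 0 the single term of index ⌈x⌉ in ω_M already
  -- outgrows x y.
  refine ⟨max 0 (Real.log (M ⌈x⌉₊)), ?_⟩
  rintro _ ⟨y, rfl⟩
  simp only [phi]
  rcases le_total y 0 with hy | hy
  · have h1 := assocFun_nonneg hM hM0 hfin (Real.exp_pos y)
    have h2 := mul_nonpos_of_nonneg_of_nonpos hx hy
    exact le_max_of_le_left (by linarith)
  · have h1 := le_assocFun hM hfin (Real.exp_pos y) ⌈x⌉₊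
    rw [Real.log_exp] at h1
    have h2 := mul_le_mul_of_nonneg_right (Nat.le_ceil x) hy
    exact le_max_of_le_right (by linarith)

/-- For a natural index `n` the matrix of `ω_M` satisfies `V^n_p ≤ (M_{n p})^{1/n}`. -/
theorem logMatrix_assocFun_le {M : ℕ → ℝ} (hM : ∀ p, 0 < M p) (hfin : FiniteAssocFun M)
    {n : ℕ} (hn : 0 < n) (p : ℕ) :
    logMatrix (assocFun M) n p ≤ Real.log (M (n * p)) / n := by
  have hn' : (0 : ℝ) < n := Nat.cast_pos.2 hn
  refine logMatrix_le hn' fun t ht => ?_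
  have h := le_assocFun hM hfin ht (n * p)
  rw [le_div_iff₀ hn', sub_mul, div_mul_cancel₀ _ hn'.ne']
  push_cast at h
  linarith

/-! ### Factorials -/

theorem log_factorial_le (p : ℕ) : Real.log (p ! : ℝ) ≤ p * Real.log p := by
  rw [← Real.log_pow]
  exact Real.log_le_log (by positivity) (by exact_mod_cast Nat.factorial_le_pow p)

theorem le_log_factorial (p : ℕ) : p * Real.log p - p ≤ Real.log (p ! : ℝ) := by
  rcases Nat.eq_zero_or_pos p with rfl | hp
  · simp
  have h := Real.pow_div_factorial_le_exp (p : ℝ) (Nat.cast_nonneg p) p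
  have h1 := Real.log_le_log (by positivity) h
  rw [Real.log_exp, Real.log_div (by positivity) (by positivity), Real.log_pow] at h1
  linarith

/-! ### Consequences of the growth condition -/

theorem exists_growthProp_of_lt {ω : ℝ → ℝ} (hγ : 1 < growthIndex ω) :
    ∃ γ : ℝ, 1 < γ ∧ GrowthProp ω γ := by
  obtain ⟨γ, h⟩ := lt_iSup_iff.1 hγ
  obtain ⟨⟨_, h1⟩, h2⟩ := lt_iSup_iff.1 h
  exact ⟨γ, by simpa using h2, h1⟩

theorem IsWeight.nonneg {ω : ℝ → ℝ} (hω : IsWeight ω) {t : ℝ} (ht : 0 ≤ t) : 0 ≤ ω t :=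
  hω.map_zero ▸ hω.monotoneOn Set.self_mem_Ici ht ht

/-- If `γ(ω) > 1` then `ω(λ u) ≤ (ε λ + D) ω(u)` for `λ ≥ 1` and large `u`. -/
theorem exists_growth_bound {ω : ℝ → ℝ} (hω : IsWeight ω) (hγ : 1 < growthIndex ω) :
    ∃ u₀ : ℝ, 1 ≤ u₀ ∧ 0 < ω u₀ ∧ ∀ ε : ℝ, 0 < ε → ∃ D : ℝ, 1 ≤ D ∧
      ∀ u, u₀ ≤ u → ∀ r, 1 ≤ r → ω (r * u) ≤ (ε * r + D) * ω u := by
  obtain ⟨γ, hγ1, K, hK, hlim⟩ := exists_growthProp_of_lt hγ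
  have hKγ : K < K ^ γ := by
    simpa using Real.rpow_lt_rpow_of_exponent_lt hK hγ1
  set B := K ^ γ with hB
  have hK0 : 0 < K := one_pos.trans hK
  have hB1 : 1 < B := hK.trans hKγ
  have hB0 : 0 < B := one_pos.trans hB1
  have hev := eventually_lt_of_limsup_lt hlim
  obtain ⟨u₀, hu₀⟩ := eventually_atTop.1
    ((hev.and (hω.tendsto_atTop.eventually_gt_atTop 0)).and (eventually_ge_atTop 1))
  have hone : 1 ≤ u₀ := (hu₀ u₀ le_rfl).2
  have hstep : ∀ u, u₀ ≤ u → ω (B * u) ≤ K * ω u := fun u hu => by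
    obtain ⟨⟨h1, h2⟩, _⟩ := hu₀ u hu
    rw [EReal.coe_lt_coe_iff, div_lt_iff₀ h2] at h1
    exact h1.le
  have hiter : ∀ n : ℕ, ∀ u, u₀ ≤ u → ω (B ^ n * u) ≤ K ^ n * ω u := by
    intro n
    induction n with
    | zero => intro u _; simp
    | succ n ih =>
      intro u hu
      have hBn : 1 ≤ B ^ n := one_le_pow₀ hB1.le
      have hu' : u₀ ≤ B ^ n * u := by nlinarith
      calc ω (B ^ (n + 1) * u) = ω (B * (B ^ n * u)) := by ring_nf
        _ ≤ K * ω (B ^ n * u) := hstep _ hu'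
        _ ≤ K * (K ^ n * ω u) := mul_le_mul_of_nonneg_left (ih u hu) hK0.le
        _ = K ^ (n + 1) * ω u := by ring
  refine ⟨u₀, hone, (hu₀ u₀ le_rfl).1.2, fun ε hε => ?_⟩
  -- Since K < B = K^γ, the ratio K/B is below 1. With B^n ≤ r < B^(n+1), iteration costs K^(n+1):
  -- at most K^(N+1) = D if n ≤ N, and K (K/B)^n B^n ≤ ε r if n ≥ N.
  obtain ⟨N, hN⟩ := exists_pow_lt_of_lt_one (div_pos hε hK0) ((div_lt_one hB0).2 hKγ)
  refine ⟨K ^ (N + 1), one_le_pow₀ hK.le, fun u hu r hr => ?_⟩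
  obtain ⟨n, hn1, hn2⟩ := exists_nat_pow_near hr hB1
  have hωu : 0 ≤ ω u := (hu₀ u hu).1.2.le
  have hu0 : 0 ≤ u := by linarith
  have h1 : ω (r * u) ≤ K ^ (n + 1) * ω u := by
    refine le_trans (hω.monotoneOn ?_ ?_ ?_) (hiter (n + 1) u hu)
    · exact Set.mem_Ici.2 (by positivity)
    · exact Set.mem_Ici.2 (by positivity)
    · exact mul_le_mul_of_nonneg_right hn2.le hu0
  refine h1.trans (mul_le_mul_of_nonneg_right ?_ hωu)
  rcases le_total n N with h | h
  · have h2 : K ^ (n + 1) ≤ K ^ (N + 1) := pow_le_pow_right₀ hK.le (by omega)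
    have h3 : 0 ≤ ε * r := by positivity
    linarith
  · have h2 : (K / B) ^ n ≤ ε / K :=
      (pow_le_pow_of_le_one (by positivity) ((div_lt_one hB0).2 hKγ).le h).trans hN.le
    rw [div_pow, div_le_div_iff₀ (by positivity) hK0] at h2
    have h3 : ε * B ^ n ≤ ε * r := mul_le_mul_of_nonneg_left hn1 hε.le
    have h4 : 0 < K ^ (N + 1) := by positivity
    rw [pow_succ]
    linarith

section Main

variable {ω : ℝ → ℝ}

/-- Beyond some t₀, log t ≤ ω(t)/(x+1) makes x log t - ω(t) nonpositive; below t₀ it is at most x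
log t₀. -/
theorem IsNormalizedWeight.finiteConjugate (hω : IsNormalizedWeight ω) (h3 : Omega3 ω) :
    FiniteConjugate ω := by
  intro x hx
  obtain ⟨t₀, ht₀⟩ := eventually_atTop.1
    ((h3.bound (show (0 : ℝ) < 1 / (x + 1) by positivity)).and (eventually_ge_atTop 1))
  have hone : 1 ≤ t₀ := (ht₀ t₀ le_rfl).2
  refine ⟨x * Real.log t₀, ?_⟩
  rintro _ ⟨y, rfl⟩
  have h0 : 0 ≤ ω (Real.exp y) := hω.toIsWeight.nonneg (Real.exp_pos y).le
  have hlog : 0 ≤ Real.log t₀ := Real.log_nonneg hone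
  simp only [phi]
  rcases le_total t₀ (Real.exp y) with h | h
  · obtain ⟨h1, h2⟩ := ht₀ _ h
    rw [Real.log_exp, Real.norm_eq_abs, Real.norm_of_nonneg h0, one_div, ← div_eq_inv_mul,
      le_div_iff₀ (by positivity)] at h1
    have h5 := le_abs_self y
    have h6 : 0 ≤ y := by
      have := Real.log_nonneg h2
      rwa [Real.log_exp] at this
    have h7 : 0 ≤ x * Real.log t₀ := by positivity
    nlinarith
  · have h1 := Real.log_le_log (Real.exp_pos y) h
    rw [Real.log_exp] at h1
    have := mul_le_mul_of_nonneg_left h1 hx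
    linarith

theorem IsNormalizedWeight.map_one (hω : IsNormalizedWeight ω) : ω 1 = 0 :=
  hω.eq_zero 1 ⟨zero_le_one, le_rfl⟩

theorem IsNormalizedWeight.logMatrix_zero (hω : IsNormalizedWeight ω) (h3 : Omega3 ω)
    {x : ℝ} (hx : 0 < x) : logMatrix ω x 0 = 0 :=
  le_antisymm (logMatrix_zero_le (fun _ ht => hω.toIsWeight.nonneg ht.le) hx) <| by
    simpa using mul_log_le_logMatrix (hω.finiteConjugate h3) hx one_pos hω.map_one.le 0

/-- `ω(C t) ≤ L (ω(t) + 1)`. -/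
theorem exists_dilation_bound (hω : IsWeight ω) (hγ : 1 < growthIndex ω) {C : ℝ} (hC : 1 ≤ C) :
    ∃ L : ℝ, 0 < L ∧ ∀ t, 0 ≤ t → ω (C * t) ≤ L * (ω t + 1) := by
  obtain ⟨u₀, hu₀, hpos, h⟩ := exists_growth_bound hω hγ
  obtain ⟨D, hD, h⟩ := h 1 one_pos
  have hCu : 0 ≤ ω (C * u₀) := hω.nonneg (by positivity)
  refine ⟨1 * C + D + ω (C * u₀), by positivity, fun t ht => ?_⟩
  have h0 := hω.nonneg ht
  rcases le_total u₀ t with htu | htu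
  · have h1 := h t htu C hC
    nlinarith
  · have h1 : ω (C * t) ≤ ω (C * u₀) :=
      hω.monotoneOn (Set.mem_Ici.2 (by positivity)) (Set.mem_Ici.2 (by positivity))
        (mul_le_mul_of_nonneg_left htu (by linarith))
    nlinarith

/-- Geometric factors are absorbed by enlarging the index. -/
theorem exists_absorb (hω : IsNormalizedWeight ω) (h3 : Omega3 ω) (hγ : 1 < growthIndex ω)
    {x : ℝ} (hx : 0 < x) {C : ℝ} (hC : 0 ≤ C) :
    ∃ y : ℝ, 0 < y ∧ ∃ B : ℝ, ∀ p : ℕ, C * p + logMatrix ω x p ≤ B + logMatrix ω y p := by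
  obtain ⟨L, hL, h⟩ := exists_dilation_bound hω.toIsWeight hγ (Real.one_le_exp hC)
  refine ⟨L * x, by positivity, 1 / x, fun p => ?_⟩
  suffices logMatrix ω x p ≤ 1 / x + logMatrix ω (L * x) p - C * p by linarith
  refine logMatrix_le hx fun t ht => ?_
  -- Testing the larger index at e^C t gains exactly C p, at the price of ω(e^C t)/(L x) ≤ (ω(t) +
  -- 1)/x.
  have h1 := le_logMatrix (hω.finiteConjugate h3) (x := L * x) (by positivity)
    (mul_pos (Real.exp_pos C) ht) p
  rw [Real.log_mul (Real.exp_pos C).ne' ht.ne', Real.log_exp] at h1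
  have h2 : ω (Real.exp C * t) / (L * x) ≤ (ω t + 1) / x := by
    rw [div_le_div_iff₀ (by positivity) hx]
    nlinarith [h t ht.le]
  rw [add_div] at h2
  linarith

/-! ### The function τ: finiteness, zeros and growth -/

theorem divFactorial_pos (p : ℕ) : 0 < divFactorial (assocMatrix ω 1) p :=
  div_pos (Real.exp_pos _) (by positivity)

theorem log_divFactorial (p : ℕ) : Real.log (divFactorial (assocMatrix ω 1) p) =
    logMatrix ω 1 p - Real.log (p ! : ℝ) := by
  rw [divFactorial, assocMatrix_eq, Real.log_div (Real.exp_pos _).ne' (by positivity),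
    Real.log_exp]

theorem divFactorial_zero (hω : IsNormalizedWeight ω) (h3 : Omega3 ω) :
    divFactorial (assocMatrix ω 1) 0 = 1 := by
  simp [divFactorial, assocMatrix_eq, hω.logMatrix_zero h3]

/-- Upper bound for the terms in the supremum defining `τ`. -/
theorem tau_term_le (hω : IsNormalizedWeight ω) (h3 : Omega3 ω) {t : ℝ} (ht : 0 < t) {B : ℝ}
    (hB : 0 ≤ B) (h : ∀ p : ℕ, 0 < p → ω (Real.exp 1 * p * t) - p ≤ B) (p : ℕ) :
    p * Real.log t - Real.log (divFactorial (assocMatrix ω 1) p) ≤ B := by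
  rcases Nat.eq_zero_or_pos p with rfl | hp
  · simpa [divFactorial_zero hω h3] using hB
  have hp' : (0 : ℝ) < p := Nat.cast_pos.2 hp
  have he := Real.exp_pos 1
  -- At the point e p t the logarithm contributes p + p log p; p log p pays for log p!, and p is
  -- left over as the gain.
  have h1 := le_logMatrix (hω.finiteConjugate h3) (x := 1) (t := Real.exp 1 * p * t) one_pos
    (by positivity) p
  rw [Real.log_mul (by positivity) ht.ne', Real.log_mul he.ne' hp'.ne', Real.log_exp,
    div_one] at h1
  have h2 := h p hp
  have h3 := log_factorial_le p
  rw [log_divFactorial]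
  linarith

/-- `ω(s) ≤ ε s + B`. -/
theorem exists_le_mul_add (hω : IsWeight ω) (hγ : 1 < growthIndex ω) {ε : ℝ} (hε : 0 < ε) :
    ∃ B : ℝ, 0 ≤ B ∧ ∀ s, 0 ≤ s → ω s ≤ ε * s + B := by
  obtain ⟨u₀, hu₀, hpos, h⟩ := exists_growth_bound hω hγ
  obtain ⟨D, hD, h⟩ := h (ε / ω u₀) (by positivity)
  refine ⟨D * ω u₀, by positivity, fun s hs => ?_⟩
  rcases le_total u₀ s with hsu | hsu
  · have h1 := h u₀ le_rfl (s / u₀) ((one_le_div (by linarith)).2 hsu)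
    rw [div_mul_cancel₀ _ (by linarith), add_mul,
      show ε / ω u₀ * (s / u₀) * ω u₀ = ε * (s / u₀) by field_simp] at h1
    have h2 : ε * (s / u₀) ≤ ε * s := mul_le_mul_of_nonneg_left (div_le_self hs hu₀) hε.le
    linarith
  · have h1 : ω s ≤ ω u₀ := hω.monotoneOn hs (Set.mem_Ici.2 (hs.trans hsu)) hsu
    have h2 : 0 ≤ ε * s := by positivity
    nlinarith

theorem finiteAssocFun_divFactorial (hω : IsNormalizedWeight ω) (h3 : Omega3 ω)
    (hγ : 1 < growthIndex ω) : FiniteAssocFun (divFactorial (assocMatrix ω 1)) := by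
  intro t ht
  have he := Real.exp_pos 1
  -- This slope turns the linear bound for ω(e p t) into p + B.
  obtain ⟨B, hB, h⟩ := exists_le_mul_add hω.toIsWeight hγ
    (show 0 < 1 / (Real.exp 1 * t) by positivity)
  refine ⟨B, tau_term_le hω h3 ht hB fun p _ => ?_⟩
  have h1 := h (Real.exp 1 * p * t) (by positivity)
  rw [show 1 / (Real.exp 1 * t) * (Real.exp 1 * p * t) = p by field_simp] at h1
  linarith

/-- The function `τ` associated with `(W^1_p / p!)_p`. -/
noncomputable def tau (ω : ℝ → ℝ) : ℝ → ℝ := assocFun (divFactorial (assocMatrix ω 1))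

theorem tau_nonneg (hω : IsNormalizedWeight ω) (h3 : Omega3 ω) (hγ : 1 < growthIndex ω) {t : ℝ}
    (ht : 0 < t) : 0 ≤ tau ω t :=
  assocFun_nonneg divFactorial_pos (divFactorial_zero hω h3)
    (finiteAssocFun_divFactorial hω h3 hγ) ht

theorem finiteConjugate_tau (hω : IsNormalizedWeight ω) (h3 : Omega3 ω)
    (hγ : 1 < growthIndex ω) : FiniteConjugate (tau ω) :=
  finiteConjugate_assocFun divFactorial_pos (divFactorial_zero hω h3)
    (finiteAssocFun_divFactorial hω h3 hγ)

/-- `τ` vanishes near `0`. -/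
theorem exists_tau_nonpos (hω : IsNormalizedWeight ω) (h3 : Omega3 ω) (hγ : 1 < growthIndex ω) :
    ∃ t₀, 0 < t₀ ∧ tau ω t₀ ≤ 0 := by
  have he := Real.exp_pos 1
  obtain ⟨B, hB, h⟩ := exists_le_mul_add hω.toIsWeight hγ one_pos
  -- Vanishing on [0,1] removes the additive constant, so at t₀ = 1/(e(1+B)) each ω(e p t₀) is at
  -- most p and no term of τ is positive.
  have hlin : ∀ s, 0 ≤ s → ω s ≤ (1 + B) * s := fun s hs => by
    rcases le_total s 1 with h1 | h1
    · rw [hω.eq_zero s ⟨hs, h1⟩]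
      positivity
    · nlinarith [h s hs]
  have ht : 0 < 1 / (Real.exp 1 * (1 + B)) := by positivity
  refine ⟨_, ht, assocFun_le divFactorial_pos ht (tau_term_le hω h3 ht le_rfl fun p _ => ?_)⟩
  have h1 := hlin (Real.exp 1 * p * (1 / (Real.exp 1 * (1 + B)))) (by positivity)
  rw [show (1 + B) * (Real.exp 1 * p * (1 / (Real.exp 1 * (1 + B)))) = p by field_simp] at h1
  linarith

theorem logMatrix_tau_zero (hω : IsNormalizedWeight ω) (h3 : Omega3 ω)
    (hγ : 1 < growthIndex ω) {x : ℝ} (hx : 0 < x) : logMatrix (tau ω) x 0 = 0 := by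
  obtain ⟨t₀, ht₀, h⟩ := exists_tau_nonpos hω h3 hγ
  exact le_antisymm (logMatrix_zero_le (fun _ ht => tau_nonneg hω h3 hγ ht) hx) <| by
    simpa using mul_log_le_logMatrix (finiteConjugate_tau hω h3 hγ) hx ht₀ h 0

/-- The key estimate `τ(u / ω(u)) ≤ D ω(u)` for large `u`. -/
theorem exists_tau_div_le (hω : IsNormalizedWeight ω) (h3 : Omega3 ω) (hγ : 1 < growthIndex ω) :
    ∃ D u₀ : ℝ, 1 ≤ D ∧ 1 ≤ u₀ ∧ 0 < ω u₀ ∧ ∀ u, u₀ ≤ u → tau ω (u / ω u) ≤ D * ω u := by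
  have he := Real.exp_pos 1
  obtain ⟨u₀, hu₀, hpos, h⟩ := exists_growth_bound hω.toIsWeight hγ
  -- With r = e p/ω(u), the choice ε = 1/e makes ε r ω(u) equal to p, cancelling the gain in
  -- `tau_term_le`.
  obtain ⟨D, hD, h⟩ := h (1 / Real.exp 1) (by positivity)
  refine ⟨D, u₀, hD, hu₀, hpos, fun u hu => ?_⟩
  have hu0 : 0 < u := by linarith
  have hωu : 0 < ω u := hpos.trans_le
    (hω.monotoneOn (Set.mem_Ici.2 (by linarith)) (Set.mem_Ici.2 hu0.le) hu)
  have ht : 0 < u / ω u := by positivity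
  refine assocFun_le divFactorial_pos ht (tau_term_le hω h3 ht (by positivity) fun p _ => ?_)
  have hp : (0 : ℝ) ≤ p := Nat.cast_nonneg p
  rw [show Real.exp 1 * p * (u / ω u) = Real.exp 1 * p / ω u * u by field_simp]
  rcases le_total 1 (Real.exp 1 * p / ω u) with h1 | h1
  · have h2 := h u hu _ h1
    rw [add_mul, show 1 / Real.exp 1 * (Real.exp 1 * p / ω u) * ω u = p by field_simp] at h2
    linarith
  · have h2 : ω (Real.exp 1 * p / ω u * u) ≤ ω u :=
      hω.monotoneOn (Set.mem_Ici.2 (by positivity)) (Set.mem_Ici.2 hu0.le)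
        (mul_le_of_le_one_left hu0.le h1)
    nlinarith

/-! ### Comparison of W with p! T -/

/-- `W^x_p ≤ C^p p! T^{x (D + 1)}_p`. -/
theorem exists_logMatrix_le_tau (hω : IsNormalizedWeight ω) (h3 : Omega3 ω)
    (hγ : 1 < growthIndex ω) : ∃ E : ℝ, 1 ≤ E ∧ ∀ x, 0 < x → ∃ C : ℝ, 0 ≤ C ∧ ∀ p : ℕ,
      logMatrix ω x p ≤ C * p + (Real.log (p ! : ℝ) + logMatrix (tau ω) (x * E) p) := by
  obtain ⟨D, u₀, hD, hu₀, hpos, h⟩ := exists_tau_div_le hω h3 hγ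
  -- With y = x(D+1), the costs D ω(u)/y from τ and ω(u)/y from p log ω(u) add up to ω(u)/x. In C,
  -- |log y| + 1 comes from the estimate for u ≥ u₀, and ω(u₀)/x from comparing smaller u with u₀.
  refine ⟨D + 1, by linarith, fun x hx => ⟨|Real.log (x * (D + 1))| + 1 + ω u₀ / x,
    by positivity, fun p => ?_⟩⟩
  set y := x * (D + 1) with hy
  have hy0 : 0 < y := by positivity
  rcases Nat.eq_zero_or_pos p with rfl | hp
  · simp [hω.logMatrix_zero h3 hx, logMatrix_tau_zero hω h3 hγ hy0]
  have hp1 : (1 : ℝ) ≤ p := Nat.one_le_cast.2 hp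
  have hp0 : (0 : ℝ) < p := by linarith
  have main : ∀ u, u₀ ≤ u → p * Real.log u - ω u / x ≤
      (|Real.log y| + 1) * p + (Real.log (p ! : ℝ) + logMatrix (tau ω) y p) := fun u hu => by
    have hu0 : 0 < u := by linarith
    have hωu : 0 < ω u := hpos.trans_le
      (hω.monotoneOn (Set.mem_Ici.2 (by linarith)) (Set.mem_Ici.2 hu0.le) hu)
    have h1 := le_logMatrix (finiteConjugate_tau hω h3 hγ) hy0
      (show 0 < u / ω u by positivity) p
    rw [Real.log_div hu0.ne' hωu.ne'] at h1
    have h2 : tau ω (u / ω u) / y ≤ D * ω u / y := div_le_div_of_nonneg_right (h u hu) hy0.le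
    -- This is log s ≤ s - 1 at s = ω(u)/(y p), multiplied by p.
    have h4 : p * Real.log (ω u) ≤ ω u / y + p * Real.log y + p * Real.log p := by
      have h5 := Real.log_le_sub_one_of_pos (show 0 < ω u / (y * p) by positivity)
      rw [Real.log_div hωu.ne' (by positivity), Real.log_mul hy0.ne' hp0.ne'] at h5
      have h6 := mul_le_mul_of_nonneg_left h5 hp0.le
      have h7 : p * (ω u / (y * p)) = ω u / y := by field_simp
      linarith
    have h5 : D * ω u / y + ω u / y = ω u / x := by
      rw [hy]
      field_simp
    have h6 := le_log_factorial p
    have h7 := mul_le_mul_of_nonneg_right (le_abs_self (Real.log y)) hp0.le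
    linarith
  refine logMatrix_le hx fun u hu => ?_
  have hq : 0 ≤ ω u₀ / x := by positivity
  rcases le_total u₀ u with huu | huu
  · have := main u huu
    nlinarith
  · have h1 := main u₀ le_rfl
    have h2 := mul_le_mul_of_nonneg_left (Real.log_le_log hu huu) hp0.le
    have h4 : 0 ≤ ω u / x := div_nonneg (hω.toIsWeight.nonneg hu.le) hx.le
    nlinarith

/-- `p! T^n_p ≤ e^p W^n_p` for natural indices `n`. -/
theorem logMatrix_tau_le (hω : IsNormalizedWeight ω) (h3 : Omega3 ω) (hγ : 1 < growthIndex ω)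
    {n : ℕ} (hn : 0 < n) (p : ℕ) :
    Real.log (p ! : ℝ) + logMatrix (tau ω) n p ≤ p + logMatrix ω n p := by
  have hn0 : (0 : ℝ) < n := Nat.cast_pos.2 hn
  have h1 := logMatrix_assocFun_le divFactorial_pos (finiteAssocFun_divFactorial hω h3 hγ) hn p
  rw [log_divFactorial] at h1
  have h2 : logMatrix ω 1 (n * p) / n = logMatrix ω n p := by
    simp only [logMatrix]
    push_cast
    ring_nf
  -- From log (np)! ≥ np log(np) - np, dropping np log n ≥ 0, and log p! ≤ p log p.
  have h4 : Real.log (p ! : ℝ) - p ≤ Real.log ((n * p)! : ℝ) / n := by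
    rcases Nat.eq_zero_or_pos p with rfl | hp
    · simp
    have hp0 : (0 : ℝ) < p := Nat.cast_pos.2 hp
    have h5 := le_log_factorial (n * p)
    push_cast at h5
    rw [Real.log_mul hn0.ne' hp0.ne'] at h5
    have h6 := log_factorial_le p
    have h7 : 0 ≤ Real.log n := Real.log_natCast_nonneg n
    rw [le_div_iff₀ hn0]
    have h8 : 0 ≤ n * p * Real.log n := by positivity
    nlinarith
  rw [sub_div, h2] at h1
  change logMatrix (tau ω) n p ≤ _ at h1
  linarith

/-- The matrix `p! T^x_p`. -/
noncomputable def tauMatrix (ω : ℝ → ℝ) (x : ℝ) : ℕ → ℝ := mulFactorial (assocMatrix (tau ω) x)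

theorem tauMatrix_pos (x : ℝ) (p : ℕ) : 0 < tauMatrix ω x p :=
  mul_pos (by positivity) (Real.exp_pos _)

theorem log_tauMatrix (x : ℝ) (p : ℕ) :
    Real.log (tauMatrix ω x p) = Real.log (p ! : ℝ) + logMatrix (tau ω) x p := by
  rw [tauMatrix, mulFactorial, assocMatrix_eq,
    Real.log_mul (by positivity) (Real.exp_pos _).ne', Real.log_exp]

theorem tauMatrix_zero (hω : IsNormalizedWeight ω) (h3 : Omega3 ω) (hγ : 1 < growthIndex ω)
    {x : ℝ} (hx : 0 < x) : tauMatrix ω x 0 = 1 := by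
  simp [tauMatrix, mulFactorial, assocMatrix_eq, logMatrix_tau_zero hω h3 hγ hx]

/-- `p! T^x_p ≤ e^p W^y_p` for suitable `y`. -/
theorem exists_tau_le_logMatrix (hω : IsNormalizedWeight ω) (h3 : Omega3 ω)
    (hγ : 1 < growthIndex ω) (x : ℝ) (hx : 0 < x) : ∃ y, 0 < y ∧ ∀ p : ℕ,
      Real.log (p ! : ℝ) + logMatrix (tau ω) x p ≤ p + logMatrix ω y p := by
  have hn : 0 < ⌈x⌉₊ := Nat.ceil_pos.2 hx
  refine ⟨⌈x⌉₊, Nat.cast_pos.2 hn, fun p => ?_⟩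
  have h1 := logMatrix_mono (finiteConjugate_tau hω h3 hγ) (fun _ ht => tau_nonneg hω h3 hγ ht)
    hx (Nat.le_ceil x) p
  have h2 := logMatrix_tau_le hω h3 hγ hn p
  linarith

theorem matrixEquiv_tauMatrix (hω : IsNormalizedWeight ω) (h3 : Omega3 ω)
    (hγ : 1 < growthIndex ω) : MatrixEquiv (assocMatrix ω) (tauMatrix ω) := by
  constructor
  · intro x hx
    obtain ⟨E, hE, h⟩ := exists_logMatrix_le_tau hω h3 hγ
    obtain ⟨C, hC, h⟩ := h x hx
    refine ⟨x * E, by positivity, Real.exp C, Real.one_le_exp hC, fun p => ?_⟩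
    rw [assocMatrix_eq, ← Real.exp_log (tauMatrix_pos (ω := ω) (x * E) p), log_tauMatrix,
      ← Real.exp_nat_mul, ← Real.exp_add, Real.exp_le_exp]
    linarith [h p]
  · intro x hx
    obtain ⟨y, hy, h⟩ := exists_tau_le_logMatrix hω h3 hγ x hx
    refine ⟨y, hy, Real.exp 1, Real.one_le_exp zero_le_one, fun p => ?_⟩
    rw [assocMatrix_eq, ← Real.exp_log (tauMatrix_pos (ω := ω) x p), log_tauMatrix,
      ← Real.exp_nat_mul, ← Real.exp_add, Real.exp_le_exp]
    linarith [h p]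

/-! ### The function associated with the first row of the new matrix -/

/-- `ω_{\hat T^1}(t) ≤ ω(C t) / x` with finite supremum. -/
theorem exists_sigma_bound (hω : IsNormalizedWeight ω) (h3 : Omega3 ω) (hγ : 1 < growthIndex ω) :
    ∃ x C : ℝ, 0 < x ∧ 0 ≤ C ∧ ∀ t, 0 < t → ∀ p : ℕ,
      p * Real.log t - Real.log (tauMatrix ω 1 p) ≤ ω (Real.exp C * t) / x := by
  obtain ⟨E, hE, h⟩ := exists_logMatrix_le_tau hω h3 hγ
  have hE0 : 0 < E := by linarith
  -- The index 1/E is multiplied by E in the comparison, so it lands on the row of index 1.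
  obtain ⟨C, hC, h⟩ := h (1 / E) (by positivity)
  refine ⟨1 / E, C, by positivity, hC, fun t ht p => ?_⟩
  have h1 := h p
  rw [one_div_mul_cancel hE0.ne'] at h1
  have h2 := le_logMatrix (hω.finiteConjugate h3) (x := 1 / E) (by positivity)
    (mul_pos (Real.exp_pos C) ht) p
  rw [Real.log_mul (Real.exp_pos C).ne' ht.ne', Real.log_exp] at h2
  rw [log_tauMatrix]
  linarith

theorem finiteAssocFun_tauMatrix (hω : IsNormalizedWeight ω) (h3 : Omega3 ω)
    (hγ : 1 < growthIndex ω) : FiniteAssocFun (tauMatrix ω 1) := by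
  obtain ⟨x, C, _, _, h⟩ := exists_sigma_bound hω h3 hγ
  exact fun t ht => ⟨_, h t ht⟩

/-- The function associated with `p! T^1_p`. -/
noncomputable def sigma (ω : ℝ → ℝ) : ℝ → ℝ := assocFun (tauMatrix ω 1)

theorem finiteConjugate_sigma (hω : IsNormalizedWeight ω) (h3 : Omega3 ω)
    (hγ : 1 < growthIndex ω) : FiniteConjugate (sigma ω) :=
  finiteConjugate_assocFun (tauMatrix_pos 1) (tauMatrix_zero hω h3 hγ one_pos)
    (finiteAssocFun_tauMatrix hω h3 hγ)

theorem sigma_nonneg (hω : IsNormalizedWeight ω) (h3 : Omega3 ω) (hγ : 1 < growthIndex ω) {t : ℝ}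
    (ht : 0 < t) : 0 ≤ sigma ω t :=
  assocFun_nonneg (tauMatrix_pos 1) (tauMatrix_zero hω h3 hγ one_pos)
    (finiteAssocFun_tauMatrix hω h3 hγ) ht

/-- After rounding x up to n, the row of σ is at most (p! T^1)^{1/n} taken at np, hence at most
(e^{np} W^1_{np})^{1/n} = e^p W^n_p. -/
theorem exists_logMatrix_sigma_le (hω : IsNormalizedWeight ω) (h3 : Omega3 ω)
    (hγ : 1 < growthIndex ω) (x : ℝ) (hx : 0 < x) : ∃ y, 0 < y ∧ ∀ p : ℕ,
      logMatrix (sigma ω) x p ≤ p + logMatrix ω y p := by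
  have hn : 0 < ⌈x⌉₊ := Nat.ceil_pos.2 hx
  have hn0 : (0 : ℝ) < ⌈x⌉₊ := Nat.cast_pos.2 hn
  refine ⟨⌈x⌉₊, hn0, fun p => ?_⟩
  have h1 := logMatrix_mono (finiteConjugate_sigma hω h3 hγ)
    (fun _ ht => sigma_nonneg hω h3 hγ ht) hx (Nat.le_ceil x) p
  have h2 := logMatrix_assocFun_le (tauMatrix_pos 1) (finiteAssocFun_tauMatrix hω h3 hγ) hn p
  have h4 := logMatrix_tau_le hω h3 hγ one_pos (⌈x⌉₊ * p)
  rw [Nat.cast_one, ← log_tauMatrix] at h4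
  have h5 := div_le_div_of_nonneg_right h4 hn0.le
  have h6 : logMatrix ω 1 (⌈x⌉₊ * p) / ⌈x⌉₊ = logMatrix ω ⌈x⌉₊ p := by
    simp only [logMatrix]
    push_cast
    ring_nf
  rw [add_div, h6] at h5
  push_cast at h5
  rw [mul_div_cancel_left₀ _ hn0.ne'] at h5
  exact h1.trans (h2.trans h5)

/-- The bound σ(t) ≤ ω(e^C t)/z, after undoing the dilation, gives σ ≤ (L/z)(ω + 1); conjugation
reverses this inequality. -/
theorem exists_logMatrix_le_sigma (hω : IsNormalizedWeight ω) (h3 : Omega3 ω)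
    (hγ : 1 < growthIndex ω) (x : ℝ) (hx : 0 < x) : ∃ y, 0 < y ∧ ∃ B : ℝ, ∀ p : ℕ,
      logMatrix ω x p ≤ B + logMatrix (sigma ω) y p := by
  obtain ⟨z, C, hz, hC, h⟩ := exists_sigma_bound hω h3 hγ
  obtain ⟨L, hL, hdil⟩ := exists_dilation_bound hω.toIsWeight hγ (Real.one_le_exp hC)
  refine ⟨x * (L / z), by positivity, 1 / x, fun p => ?_⟩
  refine logMatrix_le hx fun t ht => ?_
  have h1 := le_logMatrix (finiteConjugate_sigma hω h3 hγ) (x := x * (L / z)) (by positivity)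
    ht p
  have h2 : sigma ω t ≤ L / z * (ω t + 1) := by
    refine (assocFun_le (tauMatrix_pos 1) ht (h t ht)).trans ?_
    rw [div_mul_eq_mul_div]
    exact div_le_div_of_nonneg_right (hdil t ht.le) hz.le
  have h4 : sigma ω t / (x * (L / z)) ≤ (ω t + 1) / x := by
    rw [div_le_div_iff₀ (by positivity) hx]
    nlinarith
  rw [add_div] at h4
  linarith

/-! ### Equality of the classes -/

section Classes

variable {E J : Type*} [AddCommGroup E] [Module ℂ E] (L : J → E →ₗ[ℂ] ℂ) (π : J → ℕ)

/-- The Roumieu type limit of a matrix. -/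
noncomputable def limitMatrix (M : ℝ → ℕ → ℝ) : TopSubspace E :=
  inductiveLimit (ι := PosReal × PosReal)
    (fun i => weightedSpace L fun j => (i.2 : ℝ) ^ π j * M i.1 (π j))
    (fun i => weightedNorm L fun j => (i.2 : ℝ) ^ π j * M i.1 (π j))

/-- The Roumieu type limit of a weight function. -/
noncomputable def limitWeight (ω : ℝ → ℝ) : TopSubspace E :=
  inductiveLimit (ι := PosReal)
    (fun l => weightedSpace L fun j => assocMatrix ω l (π j))
    (fun l => weightedNorm L fun j => assocMatrix ω l (π j))

/-- Both h^p and the C^p of the equivalence are geometric, so a larger index of W absorbs them;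
conversely h = C realizes the factor C^p. -/
theorem limitMatrix_eq_limitWeight (hω : IsNormalizedWeight ω) (h3 : Omega3 ω)
    (hγ : 1 < growthIndex ω) {M : ℝ → ℕ → ℝ} (hM : ∀ x p, 0 < M x p)
    (hequiv : MatrixEquiv (assocMatrix ω) M) : limitMatrix L π M = limitWeight L π ω := by
  refine inductiveLimit_weighted_congr L π
    (v := fun (i : PosReal × PosReal) p => (i.2 : ℝ) ^ p * M i.1 p)
    (w := fun (l : PosReal) p => assocMatrix ω l p)
    (fun i p => mul_pos (pow_pos i.2.2 p) (hM _ _)) (fun _ _ => Real.exp_pos _) ?_ ?_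
  · rintro ⟨⟨x, hx⟩, ⟨h, hh⟩⟩
    obtain ⟨y, hy, C, hC, H⟩ := hequiv.2 x hx
    have hC0 : 0 < C := by linarith
    obtain ⟨z, hz, B, H'⟩ := exists_absorb hω h3 hγ hy (abs_nonneg (Real.log (h * C)))
    refine ⟨⟨z, hz⟩, Real.exp B, Real.exp_pos B, fun p => ?_⟩
    have hhC : 0 < h * C := mul_pos hh hC0
    calc h ^ p * M x p ≤ h ^ p * (C ^ p * assocMatrix ω y p) :=
          mul_le_mul_of_nonneg_left (H p) (pow_pos hh p).le
      _ = Real.exp (p * Real.log (h * C) + logMatrix ω y p) := by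
          rw [Real.exp_add, Real.exp_nat_mul, Real.exp_log hhC, assocMatrix_eq, mul_pow, mul_assoc]
      _ ≤ Real.exp (B + logMatrix ω z p) := by
          have := mul_le_mul_of_nonneg_right (le_abs_self (Real.log (h * C)))
            (Nat.cast_nonneg (α := ℝ) p)
          exact Real.exp_le_exp.2 (by linarith [H' p])
      _ = Real.exp B * assocMatrix ω z p := by rw [Real.exp_add, assocMatrix_eq]
  · rintro ⟨x, hx⟩
    obtain ⟨y, hy, C, hC, H⟩ := hequiv.1 x hx
    exact ⟨(⟨y, hy⟩, ⟨C, by simp only [Set.mem_Ioi]; linarith⟩), 1, one_pos,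
      fun p => by simpa using H p⟩

theorem limitWeight_sigma (hω : IsNormalizedWeight ω) (h3 : Omega3 ω)
    (hγ : 1 < growthIndex ω) : limitWeight L π (sigma ω) = limitWeight L π ω := by
  refine inductiveLimit_weighted_congr L π
    (v := fun (l : PosReal) p => assocMatrix (sigma ω) l p)
    (w := fun (l : PosReal) p => assocMatrix ω l p)
    (fun _ _ => Real.exp_pos _) (fun _ _ => Real.exp_pos _) ?_ ?_
  · rintro ⟨x, hx⟩
    obtain ⟨y, hy, H⟩ := exists_logMatrix_sigma_le hω h3 hγ x hx
    obtain ⟨z, hz, B, H'⟩ := exists_absorb hω h3 hγ hy zero_le_one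
    refine ⟨⟨z, hz⟩, Real.exp B, Real.exp_pos B, fun p => ?_⟩
    simp only [assocMatrix_eq]
    rw [← Real.exp_add, Real.exp_le_exp]
    linarith [H p, H' p]
  · rintro ⟨x, hx⟩
    obtain ⟨y, hy, B, H⟩ := exists_logMatrix_le_sigma hω h3 hγ x hx
    refine ⟨⟨y, hy⟩, Real.exp B, Real.exp_pos B, fun p => ?_⟩
    simp only [assocMatrix_eq]
    rw [← Real.exp_add, Real.exp_le_exp]
    exact H p

theorem matrixEquiv_refl (M : ℝ → ℕ → ℝ) : MatrixEquiv M M :=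
  ⟨fun x hx => ⟨x, hx, 1, le_rfl, fun p => by simp⟩,
    fun x hx => ⟨x, hx, 1, le_rfl, fun p => by simp⟩⟩

/-- Keeping `L` and `π` abstract treats the holomorphic classes (`π = Prod.snd`) and the sequence
classes (`π = id`) at once. -/
theorem limit_eqs (hω : IsNormalizedWeight ω) (h3 : Omega3 ω) (hγ : 1 < growthIndex ω) :
    limitMatrix L π (assocMatrix ω) = limitWeight L π ω ∧
      limitWeight L π ω = limitWeight L π (sigma ω) ∧
      limitWeight L π (sigma ω) = limitMatrix L π (tauMatrix ω) := by
  have h1 := limitWeight_sigma L π hω h3 hγ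
  refine ⟨limitMatrix_eq_limitWeight L π hω h3 hγ (fun _ _ => Real.exp_pos _)
    (matrixEquiv_refl _), h1.symm, h1.trans ?_⟩
  exact (limitMatrix_eq_limitWeight L π hω h3 hγ tauMatrix_pos
    (matrixEquiv_tauMatrix hω h3 hγ)).symm

end Classes

/-! ### Regularity of the new matrix -/

theorem LogConvex.monotone {M : ℕ → ℝ} (hM : LogConvex M) (hpos : ∀ p, 0 < M p)
    (h01 : M 0 ≤ M 1) : Monotone M := by
  refine monotone_nat_of_le_succ fun n => ?_
  induction n with
  | zero => exact h01
  | succ n ih =>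
    have h1 := hM n
    have h2 := hpos n
    have h3 := hpos (n + 1)
    have h4 := hpos (n + 2)
    refine le_of_mul_le_mul_left ?_ h3
    calc M (n + 1) * M (n + 1) = M (n + 1) ^ 2 := (sq _).symm
      _ ≤ M n * M (n + 2) := h1
      _ ≤ M (n + 1) * M (n + 2) := mul_le_mul_of_nonneg_right ih h4.le

theorem logConvex_factorial : LogConvex fun p => (p ! : ℝ) := by
  intro j
  have h : ((j + 1)! ^ 2 : ℕ) ≤ j ! * (j + 2)! := by
    simp only [Nat.factorial_succ]
    nlinarith [Nat.zero_le ((j + 1) * j ! * j !)]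
  change ((j + 1)! : ℝ) ^ 2 ≤ (j ! : ℝ) * ((j + 2)! : ℝ)
  exact_mod_cast h

theorem LogConvex.mul {M N : ℕ → ℝ} (hM : LogConvex M) (hN : LogConvex N)
    (hM0 : ∀ p, 0 < M p) : LogConvex fun p => M p * N p := by
  intro j
  have := mul_le_mul (hM j) (hN j) (sq_nonneg _) (mul_pos (hM0 _) (hM0 _)).le
  calc (M (j + 1) * N (j + 1)) ^ 2 = M (j + 1) ^ 2 * N (j + 1) ^ 2 := mul_pow _ _ _
    _ ≤ _ := this
    _ = _ := by ring

theorem logConvex_pow (c : ℝ) : LogConvex fun p => c ^ p := fun j => le_of_eq (by ring)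

/-- A zero of τ at t₀ forces T^x_p ≥ t₀^p, so c t₀ ≥ 1 leaves at least p! in every row; this gives
both the normalization at p = 1 and the divergence of the roots. -/
theorem isStandardLogConvex_of_tau_nonpos (hω : IsNormalizedWeight ω) (h3 : Omega3 ω)
    (hγ : 1 < growthIndex ω) {c t₀ : ℝ} (hc : 0 < c) (ht₀ : 0 < t₀) (hτ : tau ω t₀ ≤ 0)
    (hct : 1 ≤ c * t₀) : IsStandardLogConvex fun x p => c ^ p * tauMatrix ω x p := by
  have hfin := finiteConjugate_tau hω h3 hγ
  have hpos : ∀ x p, 0 < c ^ p * tauMatrix ω x p := fun x p =>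
    mul_pos (pow_pos hc p) (tauMatrix_pos x p)
  have hlower : ∀ x, 0 < x → ∀ p : ℕ, (p ! : ℝ) ≤ c ^ p * tauMatrix ω x p := fun x hx p => by
    have h1 : t₀ ^ p ≤ assocMatrix (tau ω) x p := by
      rw [assocMatrix_eq, ← Real.log_le_iff_le_exp (pow_pos ht₀ p), Real.log_pow]
      exact mul_log_le_logMatrix hfin hx ht₀ hτ p
    calc (p ! : ℝ) ≤ (c * t₀) ^ p * p ! :=
          le_mul_of_one_le_left (by positivity) (one_le_pow₀ hct)
      _ = c ^ p * (p ! * t₀ ^ p) := by ring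
      _ ≤ c ^ p * (p ! * assocMatrix (tau ω) x p) := by gcongr
  have hone : ∀ x, 0 < x → 1 ≤ c ^ 1 * tauMatrix ω x 1 := fun x hx => by
    simpa using hlower x hx 1
  have hzero : ∀ x, 0 < x → c ^ 0 * tauMatrix ω x 0 = 1 := fun x hx => by
    simp [tauMatrix_zero hω h3 hγ hx]
  have hconv : ∀ x, 0 < x → LogConvex fun p => c ^ p * tauMatrix ω x p := fun x hx =>
    (logConvex_pow c).mul (logConvex_factorial.mul (logConvex_assocMatrix hfin hx)
      fun p => by positivity) (pow_pos hc)
  refine ⟨fun x hx => ⟨hpos x, hzero x hx, hone x hx, hconv x hx, ?_⟩,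
    fun x hx => (hconv x hx).monotone (hpos x) ((hzero x hx).trans_le (hone x hx)),
    fun x y hx hxy p => ?_⟩
  · have hlim : Tendsto (fun p : ℕ => (p : ℝ) / Real.exp 1) atTop atTop :=
      tendsto_natCast_atTop_atTop.atTop_div_const (Real.exp_pos 1)
    refine tendsto_atTop_mono' _ ?_ hlim
    filter_upwards [eventually_gt_atTop 0] with p hp
    have hp0 : (0 : ℝ) < p := Nat.cast_pos.2 hp
    rw [one_div, Real.le_rpow_inv_iff_of_pos (by positivity) (hpos x p).le hp0,
      Real.rpow_natCast]
    refine le_trans ?_ (hlower x hx p)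
    -- The remaining inequality is (p/e)^p ≤ p!.
    rw [← Real.log_le_log_iff (by positivity) (by positivity), Real.log_pow,
      Real.log_div hp0.ne' (Real.exp_pos 1).ne', Real.log_exp, mul_sub, mul_one]
    exact le_log_factorial p
  · refine mul_le_mul_of_nonneg_left (mul_le_mul_of_nonneg_left ?_ (by positivity))
      (pow_pos hc p).le
    exact Real.exp_le_exp.2
      (logMatrix_mono hfin (fun _ ht => tau_nonneg hω h3 hγ ht) hx hxy p)

theorem stronglyLogConvex_tauMatrix (hω : IsNormalizedWeight ω) (h3 : Omega3 ω)
    (hγ : 1 < growthIndex ω) {x : ℝ} (hx : 0 < x) : StronglyLogConvex (tauMatrix ω x) := by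
  have h : divFactorial (tauMatrix ω x) = assocMatrix (tau ω) x := by
    funext p
    simp only [divFactorial, tauMatrix, mulFactorial]
    exact mul_div_cancel_left₀ _ (by positivity)
  rw [StronglyLogConvex, h]
  exact logConvex_assocMatrix (finiteConjugate_tau hω h3 hγ) hx

end Main

end Ultraholo

theorem corollary4p6 (ω : ℝ → ℝ) (hω : IsNormalizedWeight ω) (h3 : Omega3 ω) (h4 : Omega4 ω)
    (hγ : 1 < growthIndex ω) :
    let Ω : ℝ → ℕ → ℝ := assocMatrix ω
    let τ : ℝ → ℝ := assocFun (divFactorial (Ω 1))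
    let T : ℝ → ℕ → ℝ := assocMatrix τ
    let That : ℝ → ℕ → ℝ := fun x => mulFactorial (T x)
    (∀ d γ : ℝ, 0 < γ →
      classA_matrix Ω d γ = classA_weight ω d γ ∧
      classA_weight ω d γ = classA_weight (assocFun (That 1)) d γ ∧
      classA_weight (assocFun (That 1)) d γ = classA_matrix That d γ) ∧
    (classLambda_matrix Ω = classLambda_weight ω ∧
      classLambda_weight ω = classLambda_weight (assocFun (That 1)) ∧
      classLambda_weight (assocFun (That 1)) = classLambda_matrix That) ∧
    MatrixEquiv Ω That ∧
    (∀ x, 0 < x → StronglyLogConvex (That x)) ∧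
    (∃ c : ℝ, 1 ≤ c ∧ IsStandardLogConvex fun x p => c ^ p * That x p) ∧
    (IsNormalizedWeight τ → IsStandardLogConvex That) := by
  intro Ω τ T That
  refine ⟨fun d γ _ => limit_eqs (derivAt d γ) Prod.snd hω h3 hγ,
    limit_eqs coord id hω h3 hγ, matrixEquiv_tauMatrix hω h3 hγ,
    fun x hx => stronglyLogConvex_tauMatrix hω h3 hγ hx, ?_, fun hτ => ?_⟩
  · obtain ⟨t₀, ht₀, h⟩ := exists_tau_nonpos hω h3 hγ
    refine ⟨max 1 (1 / t₀), le_max_left _ _, isStandardLogConvex_of_tau_nonpos hω h3 hγ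
      (zero_lt_one.trans_le (le_max_left _ _)) ht₀ h ?_⟩
    exact (div_le_iff₀ ht₀).1 (le_max_right _ _)
  -- A normalized τ vanishes at 1, so t₀ = c = 1 is allowed and the geometric factor disappears.
  · have h := isStandardLogConvex_of_tau_nonpos hω h3 hγ one_pos one_pos hτ.map_one.le (by simp)
    simp only [one_pow, one_mul] at h
    exact h
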